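/- Let $\mathfrak g$ be a finite-dimensional real Lie algebra and $A$ a skew-symmetric bilinear form on $\mathfrak g$. On the dual space $\mathfrak g^*$ (whose cotangent spaces are identified with $\mathfrak g$) consider the Lie–Poisson tensor $P_0(x)(\xi,\eta)=x([\xi,\eta])$ and the constant tensor $P_\infty(x)(\xi,\eta)=A(\xi,\eta)$, with brackets $\{f,g\}(x)=P(x)(df(x),dg(x))$. Assume that the two brackets are compatible, i.e. that all their linear combinations are Poisson brackets, and let $\Pi(\mathfrak g,A)=\{P_\lambda\}_{\lambda\in\mathbb R\cup\{\infty\}}$, where $P_\lambda=P_0-\lambda P_\infty$ for $\lambda\in\mathbb R$, be the linear Poisson pencil that they generate. Assume that the pencil is compact: there is an element $\nu$ of the center of $\operatorname{Ker}A=\{\xi: A(\xi,\cdot)=0\}$ such that the form $A^\nu(\xi,\eta)=A([\nu,\xi],\eta)$ is positive-definite on $\mathfrak g/\operatorname{Ker}A$. Let $v$ be a vector field on an open neighbourhood $U$ of the origin in $\mathfrak g^*$ (for example $U=\mathfrak g^*$) which is bi-Hamiltonian with respect to $\Pi(\mathfrak g,A)$, i.e. for every $\lambda\in\mathbb R\cup\{\infty\}$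 there is a smooth function $H_\lambda$ on $U$ with $v=P_\lambda\,dH_\lambda$ on $U$. Then the origin is a (Lyapunov, nonlinearly) stable equilibrium of $v$: $v(0)=0$, and for every neighbourhood $N$ of $0$ there is a neighbourhood $W$ of $0$ such that the solutions of $\dot x=v(x)$ in $U$ that start in $W$ exist for all $t\ge 0$ and stay in $N$. -/

import Mathlib

open scoped ContDiff Topology
open Set

noncomputable section

namespace BiHam

variable {V : Type*} [AddCommGroup V] [Module ℝ V] [FiniteDimensional ℝ V]

/-- The dual of a finite-dimensional real vector space is a manifold through any norm on it. All
norms are equivalent; the one used here is the maximum of the absolute values of the coordinates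
`x (b i)`, where `b` is some basis of `V`. -/
instance dualNormedAddCommGroup : NormedAddCommGroup (Module.Dual ℝ V) :=
  NormedAddCommGroup.induced (Module.Dual ℝ V) (Module.Free.ChooseBasisIndex ℝ V → ℝ)
    ((Module.Free.chooseBasis ℝ V).constr ℝ).symm
    ((Module.Free.chooseBasis ℝ V).constr ℝ).symm.injective

instance dualNormedSpace : NormedSpace ℝ (Module.Dual ℝ V) :=
  NormedSpace.induced ℝ (Module.Dual ℝ V) (Module.Free.ChooseBasisIndex ℝ V → ℝ)
    ((Module.Free.chooseBasis ℝ V).constr ℝ).symm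

/-- The differential at `x` of a function on `V*`. It lies in the cotangent space of `V*` at `x`,
that is in `V** = V`: it is the `ξ : V` such that `fderiv ℝ f x y = y ξ` for all `y`. -/
def diff (f : Module.Dual ℝ V → ℝ) (x : Module.Dual ℝ V) : V :=
  (Module.evalEquiv ℝ V).symm (fderiv ℝ f x).toLinearMap

/-- Fields of bilinear forms on the cotangent spaces of the manifold `V*`. -/
abbrev BivectorField (V : Type*) [AddCommGroup V] [Module ℝ V] : Type _ :=
  Module.Dual ℝ V → LinearMap.BilinForm ℝ V

/-- The bracket `{f, g}_P = P(df, dg)`. -/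
def bracket (P : BivectorField V) (f g : Module.Dual ℝ V → ℝ) : Module.Dual ℝ V → ℝ :=
  fun x => P x (diff f x) (diff g x)

/-- `P` is a Poisson tensor on `V*`: a smooth bivector field whose bracket satisfies the Jacobi
identity. -/
structure IsPoisson (P : BivectorField V) : Prop where
  smooth : ∀ ξ η : V, ContDiff ℝ ∞ (fun x => P x ξ η)
  skew : ∀ x, (P x).IsAlt
  jacobi : ∀ f g h : Module.Dual ℝ V → ℝ,
    ContDiff ℝ ∞ f → ContDiff ℝ ∞ g → ContDiff ℝ ∞ h → ∀ x,
      bracket P (bracket P f g) h x + bracket P (bracket P g h) f x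
        + bracket P (bracket P h f) g x = 0

/-- Two Poisson brackets are compatible if all their linear combinations are Poisson brackets. -/
def Compatible (P Q : BivectorField V) : Prop :=
  IsPoisson P ∧ IsPoisson Q ∧ ∀ a b : ℝ, IsPoisson (a • P + b • Q)

/-- The pencil `P_l = P₀ - l P_∞`, for `l` in `ℝ ∪ {∞}`, generated by `P₀` and `P_∞`. -/
def pencil (P₀ P_inf : BivectorField V) : OnePoint ℝ → BivectorField V :=
  fun l => l.elim P_inf (fun r : ℝ => P₀ - r • P_inf)

/-- The vector field `v` is Hamiltonian on `U` with respect to `P`: `v = P dH` on `U` for some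
smooth function `H` on `U`. -/
def IsHamiltonianOn (P : BivectorField V) (U : Set (Module.Dual ℝ V))
    (v : Module.Dual ℝ V → Module.Dual ℝ V) : Prop :=
  ∃ H : Module.Dual ℝ V → ℝ, ContDiffOn ℝ ∞ H U ∧ ∀ x ∈ U, v x = P x (diff H x)

/-- `v` is bi-Hamiltonian on `U` with respect to a pencil: it is Hamiltonian with respect to all
brackets of the pencil. -/
def IsBiHamiltonianOn (Pen : OnePoint ℝ → BivectorField V) (U : Set (Module.Dual ℝ V))
    (v : Module.Dual ℝ V → Module.Dual ℝ V) : Prop :=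
  ∀ l : OnePoint ℝ, IsHamiltonianOn (Pen l) U v

/-- `γ` solves `γ' = v(γ)` in `U` on the time interval `J`. -/
def IsSolutionOn {E : Type*} [NormedAddCommGroup E] [NormedSpace ℝ E]
    (U : Set E) (v : E → E) (J : Set ℝ) (γ : ℝ → E) : Prop :=
  ∀ t ∈ J, γ t ∈ U ∧ HasDerivWithinAt γ (v (γ t)) J t

/-- `x₀` is a Lyapunov stable equilibrium of the vector field `v` on `U`: it is a zero of `v`, and
for every neighbourhood `N` of `x₀` there is a neighbourhood `W` of `x₀` such that the solutions
which start in `W` exist for all positive times and do not leave `N`. -/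
def IsStableEquilibrium {E : Type*} [NormedAddCommGroup E] [NormedSpace ℝ E]
    (U : Set E) (v : E → E) (x₀ : E) : Prop :=
  v x₀ = 0 ∧ ∀ N ∈ 𝓝 x₀, ∃ W ∈ 𝓝 x₀, ∀ x ∈ W,
    (∃ γ : ℝ → E, γ 0 = x ∧ IsSolutionOn U v (Ici 0) γ) ∧
    ∀ (T : ℝ) (γ : ℝ → E), γ 0 = x → IsSolutionOn U v (Icc 0 T) γ → ∀ t ∈ Icc 0 T, γ t ∈ N

end BiHam

namespace BiHam

/-- The Lie-Poisson tensor `P₀(x)(ξ, η) = x([ξ, η])` on the dual of a Lie algebra. -/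
def liePoisson (𝔤 : Type*) [LieRing 𝔤] [LieAlgebra ℝ 𝔤] : BivectorField 𝔤 :=
  fun x => (LieModule.toEnd ℝ 𝔤 𝔤 : 𝔤 →ₗ[ℝ] Module.End ℝ 𝔤).compr₂ x

/-- The bilinear form `A`, considered as a constant tensor on the dual space. -/
def constPoisson {𝔤 : Type*} [LieRing 𝔤] [LieAlgebra ℝ 𝔤] (A : LinearMap.BilinForm ℝ 𝔤) :
    BivectorField 𝔤 :=
  fun _ => A

/-- The pair `(𝔤, A)` defines a linear pencil: `A` is a skew-symmetric bilinear form on `𝔤`, and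
the constant bracket given by `A` is compatible with the Lie-Poisson bracket. -/
def DefinesLinearPencil {𝔤 : Type*} [LieRing 𝔤] [LieAlgebra ℝ 𝔤] [FiniteDimensional ℝ 𝔤]
    (A : LinearMap.BilinForm ℝ 𝔤) : Prop :=
  A.IsAlt ∧ Compatible (liePoisson 𝔤) (constPoisson A)

/-- The linear pencil `Π(𝔤, A)`. -/
def linearPencil {𝔤 : Type*} [LieRing 𝔤] [LieAlgebra ℝ 𝔤]
    (A : LinearMap.BilinForm ℝ 𝔤) : OnePoint ℝ → BivectorField 𝔤 :=
  pencil (liePoisson 𝔤) (constPoisson A)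

/-- The form `A^ν(ξ, η) = A([ν, ξ], η)`. -/
def nuForm {𝔤 : Type*} [LieRing 𝔤] [LieAlgebra ℝ 𝔤] (A : LinearMap.BilinForm ℝ 𝔤) (ν : 𝔤) :
    LinearMap.BilinForm ℝ 𝔤 :=
  A ∘ₗ (LieModule.toEnd ℝ 𝔤 𝔤 ν : 𝔤 →ₗ[ℝ] 𝔤)

/-- The linear pencil `Π(𝔤, A)` is compact: there is a `ν` in the center of `Ker A` such that
`A^ν` is positive-definite on `𝔤 / Ker A`. (The nonzero elements of `𝔤 / Ker A` are the classes
of the `ξ ∉ Ker A`.) -/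
def IsCompactLinearPencil {𝔤 : Type*} [LieRing 𝔤] [LieAlgebra ℝ 𝔤]
    (A : LinearMap.BilinForm ℝ 𝔤) : Prop :=
  ∃ ν ∈ LinearMap.ker A, (∀ η ∈ LinearMap.ker A, ⁅ν, η⁆ = 0) ∧
    ∀ ξ : 𝔤, ξ ∉ LinearMap.ker A → 0 < nuForm A ν ξ ξ

end BiHam

end

/-! Stability comes from a positive-definite quadratic first integral `q`, built in
`exists_quadratic_integral`. Since `A` is skew and `ad ν` is skew for `A`, the form `S = A^ν` is
symmetric with kernel `Ker A`, so each functional `x ∘ ad ν` equals `S (ζ x)` for some `ζ x`. Put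
`q(x, x) = S (ζ x) (ζ x)` plus the sum of squares of `x` on a basis of `Ker A`. With `v x = A h`,
the derivative of `q` along `v` is a multiple of `x([ν, h])`.

This pairing vanishes because `v = P_λ dH_λ` annihilates the kernel of `P_λ(x)` for every `λ`. With
`λ = 1/ε` and `ε → 0`, these kernels contain vectors `n` tending to `ν`. From `A(n, h) = 0` and
`A(n, h) = ε x([n, h])` follows `x([n, h]) = 0`, and the limit gives `x([ν, h]) = 0`. The vectors
`n` are images of `ν` under inner automorphisms of the central extension of the Lie algebra by the
cocycle `A`, found with the inverse function theorem
(`apply_bracket_eq_zero_of_orthogonal_kernels_of_normed`). -/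

namespace BiHam

/-! ### Lyapunov stability from a definite quadratic integral. -/

section Stability

variable {E : Type*} [NormedAddCommGroup E] [NormedSpace ℝ E]

/-- A bounded, globally Lipschitz vector field has solutions on every interval `[0, T]`. -/
theorem exists_solution_Icc_of_lipschitz [CompleteSpace E] {w : E → E} {K : NNReal}
    (hK : LipschitzWith K w) {C : NNReal} (hC : ∀ x, ‖w x‖ ≤ C) (x : E) {T : ℝ} (hT : 0 ≤ T) :
    ∃ γ : ℝ → E, γ 0 = x ∧ ∀ t ∈ Icc 0 T, HasDerivWithinAt γ (w (γ t)) (Icc 0 T) t := by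
  have h := IsPicardLindelof.of_time_independent (f := w) (tmin := 0) (tmax := T)
    (t₀ := ⟨0, left_mem_Icc.2 hT⟩) (x₀ := x) (a := C * T.toNNReal) (r := 0) (L := C) (K := K)
    (fun y _ => hC y) hK.lipschitzOnWith (by simp [hT])
  exact h.exists_eq_forall_mem_Icc_hasDerivWithinAt₀

/-- A bounded, globally Lipschitz vector field has solutions for all positive times. -/
theorem exists_solution_Ici_of_lipschitz [CompleteSpace E] {w : E → E} {K : NNReal}
    (hK : LipschitzWith K w) {C : NNReal} (hC : ∀ x, ‖w x‖ ≤ C) (x : E) :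
    ∃ γ : ℝ → E, γ 0 = x ∧ ∀ t ∈ Ici (0 : ℝ), HasDerivWithinAt γ (w (γ t)) (Ici 0) t := by
  have hex : ∀ T : ℝ, ∃ γ : ℝ → E, 0 ≤ T → (γ 0 = x ∧
      ∀ t ∈ Icc 0 T, HasDerivWithinAt γ (w (γ t)) (Icc 0 T) t) := by
    intro T
    by_cases hT : 0 ≤ T
    · obtain ⟨γ, h⟩ := exists_solution_Icc_of_lipschitz hK hC x hT
      exact ⟨γ, fun _ => h⟩
    · exact ⟨0, fun h => absurd h hT⟩
  choose α hα using hex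
  have hcont : ∀ T : ℝ, 0 ≤ T → ContinuousOn (α T) (Icc 0 T) := fun T hT t ht =>
    ((hα T hT).2 t ht).continuousWithinAt
  have hright : ∀ T : ℝ, 0 ≤ T → ∀ t ∈ Ico 0 T,
      HasDerivWithinAt (α T) (w (α T t)) (Ici t) t := by
    intro T hT t ht
    refine ((hα T hT).2 t ⟨ht.1, ht.2.le⟩).mono_of_mem_nhdsWithin ?_
    exact Filter.mem_of_superset (Icc_mem_nhdsGE ht.2) (Icc_subset_Icc_left ht.1)
  have huniq : ∀ S T : ℝ, 0 ≤ S → S ≤ T → EqOn (α S) (α T) (Icc 0 S) := by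
    intro S T hS hST
    refine ODE_solution_unique_of_mem_Icc_right (v := fun _ => w) (s := fun _ => univ) (K := K)
      (fun _ _ => hK.lipschitzOnWith) (hcont S hS) (hright S hS) (fun _ _ => mem_univ _)
      ((hcont T (hS.trans hST)).mono (Icc_subset_Icc_right hST))
      (fun t ht => hright T (hS.trans hST) t ⟨ht.1, ht.2.trans_le hST⟩) (fun _ _ => mem_univ _) ?_
    rw [(hα S hS).1, (hα T (hS.trans hST)).1]
  -- The horizon `t + 1` keeps `t` away from the right end of the interval, so derivatives within
  -- `Icc` become derivatives within `Ici 0`.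
  refine ⟨fun t => α (t + 1) t, (hα _ (by norm_num)).1, fun t ht => ?_⟩
  have ht : 0 ≤ t := ht
  have ht1 : 0 ≤ t + 1 := by linarith
  have hd : HasDerivWithinAt (α (t + 1)) (w (α (t + 1) t)) (Ici 0) t := by
    refine ((hα (t + 1) ht1).2 t ⟨ht, by linarith⟩).mono_of_mem_nhdsWithin ?_
    rw [mem_nhdsWithin]
    exact ⟨Iio (t + 1), isOpen_Iio, by simp, fun s hs => ⟨hs.2, le_of_lt hs.1⟩⟩
  refine hd.congr_of_eventuallyEq ?_ rfl
  have : Ici 0 ∩ Iio (t + 1) ∈ 𝓝[Ici 0] t :=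
    inter_mem_nhdsWithin _ (Iio_mem_nhds (by linarith))
  filter_upwards [this] with s hs
  have hs0 : (0 : ℝ) ≤ s := hs.1
  have hs1 : s < t + 1 := hs.2
  rcases le_total s t with h | h
  · exact huniq _ _ (by linarith) (by linarith) ⟨hs0, by linarith⟩
  · exact (huniq _ _ ht1 (by linarith) ⟨hs0, hs1.le⟩).symm

/-- A positive-definite bilinear form on a finite-dimensional space bounds the squared norm. -/
theorem exists_mul_sq_norm_le_of_posDef [FiniteDimensional ℝ E] (q : E →L[ℝ] E →L[ℝ] ℝ)
    (hpos : ∀ x, x ≠ 0 → 0 < q x x) : ∃ c : ℝ, 0 < c ∧ ∀ x, c * ‖x‖ ^ 2 ≤ q x x := by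
  have hq : Continuous fun x => q x x := by fun_prop
  rcases (Metric.sphere (0 : E) 1).eq_empty_or_nonempty with he | hne
  · refine ⟨1, one_pos, fun x => ?_⟩
    have : x = 0 := by
      by_contra hx
      have : ‖x‖⁻¹ • x ∈ Metric.sphere (0 : E) 1 := by
        simp [norm_smul, inv_mul_cancel₀ (norm_ne_zero_iff.2 hx)]
      rw [he] at this
      exact this
    simp [this]
  · obtain ⟨z, hz, hmin⟩ := (isCompact_sphere (0 : E) 1).exists_isMinOn hne hq.continuousOn
    have hz1 : ‖z‖ = 1 := by simpa using hz
    refine ⟨q z z, hpos z (fun h => by simp [h] at hz1), fun x => ?_⟩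
    by_cases hx : x = 0
    · simp [hx]
    have hn : ‖x‖ ≠ 0 := norm_ne_zero_iff.2 hx
    have hm : q z z ≤ q (‖x‖⁻¹ • x) (‖x‖⁻¹ • x) :=
      hmin (show ‖x‖⁻¹ • x ∈ Metric.sphere (0 : E) 1 by
        simp [norm_smul, inv_mul_cancel₀ hn])
    simp only [map_smul, smul_apply, smul_eq_mul] at hm
    calc q z z * ‖x‖ ^ 2 ≤ (‖x‖⁻¹ * (‖x‖⁻¹ * q x x)) * ‖x‖ ^ 2 := by gcongr
      _ = q x x := by field_simp

/-- A quadratic first integral is constant along solutions. -/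
theorem quadratic_eq_of_isSolutionOn {q : E →L[ℝ] E →L[ℝ] ℝ} (hsymm : ∀ x y, q x y = q y x)
    {U : Set E} {v : E → E} (hqv : ∀ x ∈ U, q x (v x) = 0) {T : ℝ} {γ : ℝ → E}
    (hγ : IsSolutionOn U v (Icc 0 T) γ) :
    ∀ t ∈ Icc 0 T, q (γ t) (γ t) = q (γ 0) (γ 0) := by
  have hd : ∀ t ∈ Icc 0 T, HasDerivWithinAt (fun s => q (γ s) (γ s)) 0 (Icc 0 T) t := by
    intro t ht
    have h := (hγ t ht).2
    have h2 := (q.hasFDerivAt.comp_hasDerivWithinAt t h).clm_apply h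
    have e : q (v (γ t)) (γ t) + q (γ t) (v (γ t)) = 0 := by
      rw [hsymm (v (γ t)), hqv _ (hγ t ht).1, add_zero]
    exact h2.congr_deriv e
  refine constant_of_has_deriv_right_zero (fun t ht => (hd t ht).continuousWithinAt) ?_
  intro t ht
  refine (hd t ⟨ht.1, ht.2.le⟩).mono_of_mem_nhdsWithin ?_
  exact Filter.mem_of_superset (Icc_mem_nhdsGE ht.2) (Icc_subset_Icc_left ht.1)

/-- A zero of a `C¹` vector field with a positive-definite quadratic first integral is stable. -/
theorem isStableEquilibrium_of_quadratic_integral [FiniteDimensional ℝ E]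
    (q : E →L[ℝ] E →L[ℝ] ℝ) (hsymm : ∀ x y, q x y = q y x) (hpos : ∀ x, x ≠ 0 → 0 < q x x)
    {U : Set E} (hU : IsOpen U) (h0 : (0 : E) ∈ U) {v : E → E} (hv : ContDiffOn ℝ 1 v U)
    (hv0 : v 0 = 0) (hqv : ∀ x ∈ U, q x (v x) = 0) : IsStableEquilibrium U v 0 := by
  have : CompleteSpace E := FiniteDimensional.complete ℝ E
  refine ⟨hv0, fun N hN => ?_⟩
  obtain ⟨R, hR, hRsub⟩ := Metric.nhds_basis_closedBall.mem_iff.1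
    (Filter.inter_mem (hU.mem_nhds h0) hN)
  obtain ⟨c, hc, hcq⟩ := exists_mul_sq_norm_le_of_posDef q hpos
  have hq : Continuous fun x => q x x := by fun_prop
  -- The cut-off field is complete and still preserves `q`. Solutions starting in a small sublevel
  -- set of `q` never leave the ball of radius `R / 2`, where the cut-off is `1`.
  let χ : ContDiffBump (0 : E) := ⟨R / 2, R, by linarith, by linarith⟩
  let w : E → E := fun x => χ x • v x
  have hwsupp : tsupport w ⊆ Metric.closedBall 0 R :=
    (tsupport_smul_subset_left _ _).trans χ.tsupport_eq.le
  have hwc : HasCompactSupport w :=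
    (isCompact_closedBall (0 : E) R).of_isClosed_subset (isClosed_tsupport _) hwsupp
  have hw : ContDiff ℝ 1 w := contDiff_iff_contDiffAt.2 fun x => by
    by_cases hx : x ∈ tsupport w
    · exact χ.contDiff.contDiffAt.smul (hv.contDiffAt (hU.mem_nhds (hRsub (hwsupp hx)).1))
    · exact contDiffAt_const.congr_of_eventuallyEq (notMem_tsupport_iff_eventuallyEq.1 hx)
  obtain ⟨K, hK⟩ := hw.lipschitzWith_of_hasCompactSupport hwc one_ne_zero
  obtain ⟨C, hC⟩ := hw.continuous.bounded_above_of_compact_support hwc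
  have hqw : ∀ x ∈ univ, q x (w x) = 0 := by
    intro x _
    by_cases hx : w x = 0
    · simp [hx]
    · have hxU : x ∈ U := (hRsub (hwsupp (subset_tsupport _ hx))).1
      simp [w, hqv x hxU]
  have hsmall : ∀ x, q x x < c * (R / 2) ^ 2 → x ∈ Metric.ball (0 : E) (R / 2) := by
    intro x hx
    rw [mem_ball_zero_iff]
    exact lt_of_pow_lt_pow_left₀ 2 (by linarith) (lt_of_mul_lt_mul_left ((hcq x).trans_lt hx) hc.le)
  refine ⟨{x | q x x < c * (R / 2) ^ 2},
    (isOpen_lt hq continuous_const).mem_nhds (by simp only [mem_ofPred_eq, map_zero]; positivity),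
    fun x hx => ⟨?_, ?_⟩⟩
  · obtain ⟨γ, hγ0, hγ⟩ := exists_solution_Ici_of_lipschitz hK
      (C := C.toNNReal) (fun x => (hC x).trans (Real.le_coe_toNNReal C)) x
    refine ⟨γ, hγ0, fun t ht => ?_⟩
    have hsol : IsSolutionOn univ w (Icc 0 t) γ := fun s hs =>
      ⟨mem_univ _, (hγ s hs.1).mono Icc_subset_Ici_self⟩
    have e := quadratic_eq_of_isSolutionOn hsymm hqw hsol t ⟨ht, le_rfl⟩
    have hb : γ t ∈ Metric.ball (0 : E) (R / 2) := hsmall _ (by rw [e, hγ0]; exact hx)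
    have hwv : w (γ t) = v (γ t) := by
      simp [w, χ.one_of_mem_closedBall (Metric.ball_subset_closedBall hb)]
    refine ⟨(hRsub (Metric.closedBall_subset_closedBall (by linarith)
      (Metric.ball_subset_closedBall hb))).1, ?_⟩
    rw [← hwv]
    exact hγ t ht
  · intro T γ hγ0 hγ t ht
    have e := quadratic_eq_of_isSolutionOn hsymm hqv hγ t ht
    have hb : γ t ∈ Metric.ball (0 : E) (R / 2) := hsmall _ (by rw [e, hγ0]; exact hx)
    exact (hRsub (Metric.closedBall_subset_closedBall (by linarith)
      (Metric.ball_subset_closedBall hb))).2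

end Stability

/-! ### Exponentials of derivations. -/

section ExpDerivation

variable {F : Type*} [NormedAddCommGroup F] [NormedSpace ℝ F] [FiniteDimensional ℝ F]

open NormedSpace in
theorem exp_apply_exp_neg_apply (D : F →L[ℝ] F) (a : F) : exp D (exp (-D) a) = a := by
  have : CompleteSpace F := FiniteDimensional.complete ℝ F
  let _ : NormedAlgebra ℚ (F →L[ℝ] F) := NormedAlgebra.restrictScalars ℚ ℝ _
  rw [← mul_apply_eq_comp, ← exp_add_of_commute (Commute.neg_right rfl), add_neg_cancel, exp_zero,
    one_apply_eq_self]

open NormedSpace in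
/-- The exponential of a derivation of a finite-dimensional algebra is an automorphism. -/
theorem exp_derivation_apply (μ : F →ₗ[ℝ] F →ₗ[ℝ] F) (D : F →L[ℝ] F)
    (hD : ∀ a b, D (μ a b) = μ (D a) b + μ a (D b)) (a b : F) :
    exp D (μ a b) = μ (exp D a) (exp D b) := by
  have : CompleteSpace F := FiniteDimensional.complete ℝ F
  let m : F →L[ℝ] F →L[ℝ] F := LinearMap.toContinuousLinearMap
    ((LinearMap.toContinuousLinearMap : (F →ₗ[ℝ] F) ≃ₗ[ℝ] (F →L[ℝ] F)).toLinearMap ∘ₗ μ)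
  have hm : ∀ a b, m a b = μ a b := fun a b => rfl
  have hexp : ∀ (c : F) (t : ℝ),
      HasDerivAt (fun s : ℝ => exp (s • D) c) (D (exp (t • D) c)) t := fun c t =>
    (hasDerivAt_exp_smul_const' (𝕂 := ℝ) D t).clm_apply (hasDerivAt_const t c) |>.congr_deriv
      (by simp)
  -- By the Leibniz rule `exp(-sD) μ(exp(sD) a, exp(sD) b)` does not depend on `s`; compare `s = 1`
  -- with `s = 0`.
  have hderiv : ∀ t : ℝ, HasDerivAt
      (fun s : ℝ => exp (s • (-D)) (m (exp (s • D) a) (exp (s • D) b))) 0 t := by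
    intro t
    have h1 := hasDerivAt_exp_smul_const (𝕂 := ℝ) (-D) t
    have h2 := (m.hasFDerivAt.comp_hasDerivAt t (hexp a t)).clm_apply (hexp b t)
    refine (h1.clm_apply h2).congr_deriv ?_
    simp only [Function.comp_apply, mul_apply_eq_comp, neg_apply, map_neg, hm, hD]
    simp only [map_add]
    abel
  have hconst := is_const_of_deriv_eq_zero (fun t => (hderiv t).differentiableAt)
    (fun t => (hderiv t).deriv) 1 0
  simp only [one_smul, zero_smul, exp_zero, hm, one_apply_eq_self] at hconst
  rw [← hconst, exp_apply_exp_neg_apply]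

end ExpDerivation

/-! ### Kernels of the pencil near `ν`. -/

section KernelApproximation

/-- A bilinear form that pairs a subspace nondegenerately induces all functionals on it. -/
theorem exists_eq_on_submodule {E : Type*} [AddCommGroup E] [Module ℝ E] [FiniteDimensional ℝ E]
    (A : LinearMap.BilinForm ℝ E) (R : Submodule ℝ E)
    (hR : ∀ r ∈ R, (∀ ξ, A ξ r = 0) → r = 0) (φ : R →ₗ[ℝ] ℝ) : ∃ ξ, ∀ r : R, A ξ r = φ r := by
  let S : R →ₗ[ℝ] Module.Dual ℝ E := A.flip ∘ₗ R.subtype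
  have hS : Function.Injective S := by
    rw [← LinearMap.ker_eq_bot, LinearMap.ker_eq_bot']
    intro r hr
    exact Subtype.ext (hR r r.2 fun ξ => LinearMap.congr_fun hr ξ)
  obtain ⟨ψ, hψ⟩ := LinearMap.dualMap_surjective_of_injective hS φ
  refine ⟨(Module.evalEquiv ℝ E).symm ψ, fun r => ?_⟩
  rw [← hψ, LinearMap.dualMap_apply, ← Module.apply_evalEquiv_symm_apply]
  rfl

-- In the central extension `E × ℝ`, the kernel condition on `n` says that `θ ε = snd - ε x`
-- vanishes on all brackets with `n`. If `θ ε ∘ exp (D ξ)` vanishes on `[ν, E]`, then `n = exp (D ξ)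
-- ν` qualifies, since `exp (D ξ)` is an automorphism. Such a small `ξ` exists for small `ε` because
-- `A` pairs `E` with `[ν, E]` nondegenerately on the side of `[ν, E]`.
open NormedSpace in
theorem apply_bracket_eq_zero_of_orthogonal_kernels_of_normed {E : Type*} [NormedAddCommGroup E] [NormedSpace ℝ E]
    [FiniteDimensional ℝ E] (br : E →ₗ[ℝ] E →ₗ[ℝ] E) (A : LinearMap.BilinForm ℝ E)
    (hjac : ∀ a b c, br a (br b c) = br (br a b) c + br b (br a c))
    (hcoc : ∀ a b c, A a (br b c) = A (br a b) c + A b (br a c))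
    (hA : A.IsAlt) {ν : E} (hν : ν ∈ LinearMap.ker A)
    (hcenter : ∀ η ∈ LinearMap.ker A, br ν η = 0)
    (hpos : ∀ ξ, ξ ∉ LinearMap.ker A → A (br ν ξ) ξ ≠ 0)
    (x : E →ₗ[ℝ] ℝ) (h : E)
    (hh : ∀ ε : ℝ, ε ≠ 0 → ∀ n, (∀ b, A n b = ε * x (br n b)) → A n h = 0) :
    x (br ν h) = 0 := by
  have : CompleteSpace E := FiniteDimensional.complete ℝ E
  have hν' : ∀ b, A ν b = 0 := fun b => by rw [LinearMap.mem_ker.1 hν]; rfl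
  let μ : (E × ℝ) →ₗ[ℝ] (E × ℝ) →ₗ[ℝ] (E × ℝ) := LinearMap.mk₂ ℝ
    (fun a b => (br a.1 b.1, A a.1 b.1)) (by intros; ext <;> simp) (by intros; ext <;> simp)
    (by intros; ext <;> simp) (by intros; ext <;> simp)
  have hμ : ∀ a b, μ a b = (br a.1 b.1, A a.1 b.1) := fun _ _ => rfl
  let D₀ : E →ₗ[ℝ] (E × ℝ) →L[ℝ] (E × ℝ) :=
    { toFun := fun ξ => LinearMap.toContinuousLinearMap (μ (ξ, 0))
      map_add' := fun a b => by ext <;> simp [hμ]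
      map_smul' := fun a b => by ext <;> simp [hμ] }
  let D : E →L[ℝ] (E × ℝ) →L[ℝ] (E × ℝ) := LinearMap.toContinuousLinearMap D₀
  have hD : ∀ ξ a, D ξ a = (br ξ a.1, A ξ a.1) := fun _ _ => rfl
  have hexp : ∀ ξ a b, exp (D ξ) (μ a b) = μ (exp (D ξ) a) (exp (D ξ) b) := fun ξ =>
    exp_derivation_apply μ (D ξ) fun a b => by
      simp only [hD, hμ]
      ext
      · exact hjac _ _ _
      · exact hcoc _ _ _
  let R : Submodule ℝ E := LinearMap.range (br ν)
  have hR : ∀ r ∈ R, (∀ ξ, A ξ r = 0) → r = 0 := by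
    rintro _ ⟨η, rfl⟩ hr
    apply hcenter
    by_contra hη
    exact hpos η hη (by rw [← hA.neg_eq, hr, neg_zero])
  let j : R →L[ℝ] (E × ℝ) := (ContinuousLinearMap.inl ℝ E ℝ).comp R.subtypeL
  let xc : E →L[ℝ] ℝ := LinearMap.toContinuousLinearMap x
  let xf : (E × ℝ) →L[ℝ] ℝ := xc.comp (ContinuousLinearMap.fst ℝ E ℝ)
  let θ : ℝ → (E × ℝ) →L[ℝ] ℝ := fun ε => ContinuousLinearMap.snd ℝ E ℝ - ε • xf
  let G₁ : E × ℝ → R →L[ℝ] ℝ := fun p => (θ p.2).comp ((exp (D p.1)).comp j)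
  let θ' : (E × ℝ) →L[ℝ] ((E × ℝ) →L[ℝ] ℝ) := -((ContinuousLinearMap.snd ℝ E ℝ).smulRight xf)
  have hθ : HasStrictFDerivAt (fun p : E × ℝ => θ p.2) θ' 0 := by
    have := ((ContinuousLinearMap.snd ℝ E ℝ).smulRight xf).hasStrictFDerivAt (x := (0 : E × ℝ))
    exact this.const_sub (ContinuousLinearMap.snd ℝ E ℝ)
  have he : HasStrictFDerivAt (fun p : E × ℝ => exp (D p.1))
      (D.comp (ContinuousLinearMap.fst ℝ E ℝ)) 0 := by
    have h1 := (D.comp (ContinuousLinearMap.fst ℝ E ℝ)).hasStrictFDerivAt (x := (0 : E × ℝ))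
    have h2 : HasStrictFDerivAt (exp : ((E × ℝ) →L[ℝ] (E × ℝ)) → _) (1 : _ →L[ℝ] _)
      ((D.comp (ContinuousLinearMap.fst ℝ E ℝ)) (0 : E × ℝ)) := by
      rw [map_zero]; exact hasStrictFDerivAt_exp_zero
    exact h2.comp (0 : E × ℝ) h1
  have hG₁ := hθ.clm_comp (he.clm_comp (hasStrictFDerivAt_const j (0 : E × ℝ)))
  have hG := hG₁.prodMk (ContinuousLinearMap.snd ℝ E ℝ).hasStrictFDerivAt
  have hmap := hG.map_nhds_eq_of_surj (by
    rw [LinearMap.range_eq_top]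
    rintro ⟨φ, s⟩
    -- The derivative of `G₁` at `0` sends `(ξ, s)` to `r ↦ A ξ r - s x r`, hence the correction `s
    -- x`.
    obtain ⟨ξ, hξ⟩ := exists_eq_on_submodule A R hR (φ + s • xc.comp R.subtypeL).toLinearMap
    refine ⟨(ξ, s), ?_⟩
    ext r
    · have := hξ r
      simp [θ', θ, xf, j, hD, this]
    · simp)
  have hz : ((G₁ 0, (ContinuousLinearMap.snd ℝ E ℝ) 0) : (R →L[ℝ] ℝ) × ℝ) = (0, 0) := by
    ext r <;> simp [G₁, θ, j, D]
  let g : E × ℝ → ℝ := fun p => x (br (exp (D p.1) (ν, 0)).1 h)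
  have hg : ContinuousAt g 0 := by
    have h1 : ContinuousAt (fun p : E × ℝ => (exp (D p.1) (ν, 0)).1) 0 :=
      (he.continuousAt.clm_apply continuousAt_const).fst
    exact (LinearMap.continuous_of_finiteDimensional (x ∘ₗ br.flip h)).continuousAt.comp h1
  by_contra hne
  have hg0 : g 0 ≠ 0 := by simpa [g] using hne
  have himage := Filter.image_mem_map (m := fun p => (G₁ p, (ContinuousLinearMap.snd ℝ E ℝ) p))
    (hg.eventually_ne hg0)
  rw [hmap, hz] at himage
  have hc : ContinuousAt (fun ε : ℝ => ((0 : R →L[ℝ] ℝ), ε)) 0 := by fun_prop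
  have hev := Filter.eventually_mem_set.2 (hc.preimage_mem_nhds himage)
  -- Openness of the map at `0` solves `G₁ (ξ, ε) = 0` for some `ε ≠ 0`, with `(ξ, ε)` so close to
  -- `0` that `g` is still nonzero.
  obtain ⟨ε, ⟨⟨ξ, ε'⟩, hgξ, heq⟩, hε⟩ :=
    ((hev.filter_mono nhdsWithin_le_nhds).and (self_mem_nhdsWithin (s := {0}ᶜ))).exists
  obtain ⟨hG0, rfl⟩ : G₁ (ξ, ε') = 0 ∧ ε' = ε := by simpa using heq
  have hker : ∀ b, A (exp (D ξ) (ν, 0)).1 b = ε' * x (br (exp (D ξ) (ν, 0)).1 b) := by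
    intro b
    -- Pulling `b` back turns its bracket with `n` into the image of `[ν, η]`, on which `θ ε'`
    -- vanishes.
    let η := exp (-(D ξ)) (b, 0)
    have h1 := hexp ξ (ν, 0) η
    rw [exp_apply_exp_neg_apply] at h1
    have h2 : μ (ν, 0) η = j ⟨br ν η.1, ⟨η.1, rfl⟩⟩ := by simp [hμ, hν', j]
    have h3 : G₁ (ξ, ε') ⟨br ν η.1, ⟨η.1, rfl⟩⟩ = 0 := by rw [hG0]; rfl
    have h4 : G₁ (ξ, ε') ⟨br ν η.1, ⟨η.1, rfl⟩⟩ = θ ε' (exp (D ξ) (μ (ν, 0) η)) := by rw [h2]; rfl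
    rw [h3, h1, hμ] at h4
    simp only [θ, xf, xc, sub_apply, smul_apply, ContinuousLinearMap.comp_apply,
      ContinuousLinearMap.coe_fst', ContinuousLinearMap.coe_snd', smul_eq_mul,
      LinearMap.coe_toContinuousLinearMap'] at h4
    linarith
  have hAh := hh ε' hε _ hker
  rw [hker] at hAh
  exact hgξ ((mul_eq_zero.1 hAh).resolve_left hε)

/-- If `h` is `A`-orthogonal to the kernels of all the forms `A - ε x([·,·])` with `ε ≠ 0`, then
`x([ν, h]) = 0`: these kernels contain vectors close to `ν` when `ε` is small. -/
theorem apply_bracket_eq_zero_of_orthogonal_kernels {E : Type*} [AddCommGroup E] [Module ℝ E]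
    [FiniteDimensional ℝ E] (br : E →ₗ[ℝ] E →ₗ[ℝ] E) (A : LinearMap.BilinForm ℝ E)
    (hjac : ∀ a b c, br a (br b c) = br (br a b) c + br b (br a c))
    (hcoc : ∀ a b c, A a (br b c) = A (br a b) c + A b (br a c))
    (hA : A.IsAlt) {ν : E} (hν : ν ∈ LinearMap.ker A)
    (hcenter : ∀ η ∈ LinearMap.ker A, br ν η = 0)
    (hpos : ∀ ξ, ξ ∉ LinearMap.ker A → A (br ν ξ) ξ ≠ 0)
    (x : E →ₗ[ℝ] ℝ) (h : E)
    (hh : ∀ ε : ℝ, ε ≠ 0 → ∀ n, (∀ b, A n b = ε * x (br n b)) → A n h = 0) :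
    x (br ν h) = 0 := by
  let e := (Module.finBasis ℝ E).equivFun
  let _ : NormedAddCommGroup E := NormedAddCommGroup.induced E _ e e.injective
  let _ : NormedSpace ℝ E := NormedSpace.induced ℝ E _ e
  exact apply_bracket_eq_zero_of_orthogonal_kernels_of_normed br A hjac hcoc hA hν hcenter hpos x h
    hh

end KernelApproximation

/-! ### Representing functionals by a degenerate symmetric form. -/

section DualForm

variable {E : Type*} [AddCommGroup E] [Module ℝ E] [FiniteDimensional ℝ E]

/-- A symmetric form represents the functionals that vanish on its kernel. -/
theorem exists_apply_eq_of_ker_le {S : LinearMap.BilinForm ℝ E} (hS : ∀ a b, S a b = S b a)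
    {y : Module.Dual ℝ E} (hy : ∀ k ∈ LinearMap.ker S, y k = 0) : ∃ ζ, S ζ = y := by
  have hmem : y ∈ (LinearMap.ker S).dualAnnihilator :=
    (Submodule.mem_dualAnnihilator _).2 hy
  rw [← LinearMap.range_dualMap_eq_dualAnnihilator_ker] at hmem
  obtain ⟨ψ, rfl⟩ := hmem
  refine ⟨(Module.evalEquiv ℝ E).symm ψ, ?_⟩
  ext b
  rw [hS, Module.apply_evalEquiv_symm_apply]
  rfl

/-- A linear choice of representatives, for functionals that depend linearly on a parameter. -/
theorem exists_linearMap_apply_eq_of_ker_le {F : Type*} [AddCommGroup F] [Module ℝ F]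
    {S : LinearMap.BilinForm ℝ E} (hS : ∀ a b, S a b = S b a) (f : F →ₗ[ℝ] Module.Dual ℝ E)
    (hf : ∀ x, ∀ k ∈ LinearMap.ker S, f x k = 0) : ∃ ζ : F →ₗ[ℝ] E, ∀ x, S (ζ x) = f x := by
  obtain ⟨s, hs⟩ := S.rangeRestrict.exists_rightInverse_of_surjective S.range_rangeRestrict
  refine ⟨s ∘ₗ f.codRestrict (LinearMap.range S) fun x => exists_apply_eq_of_ker_le hS (hf x),
    fun x => ?_⟩
  exact congrArg Subtype.val (LinearMap.congr_fun hs
    (f.codRestrict (LinearMap.range S) (fun x => exists_apply_eq_of_ker_le hS (hf x)) x))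

end DualForm

/-! ### The first integral of a compact linear pencil. -/

section LinearPencil

variable {𝔤 : Type*} [LieRing 𝔤] [LieAlgebra ℝ 𝔤]

theorem liePoisson_apply (x : Module.Dual ℝ 𝔤) (ξ η : 𝔤) : liePoisson 𝔤 x ξ η = x ⁅ξ, η⁆ := rfl

theorem nuForm_apply (A : LinearMap.BilinForm ℝ 𝔤) (ν ξ η : 𝔤) :
    nuForm A ν ξ η = A ⁅ν, ξ⁆ η := rfl

variable [FiniteDimensional ℝ 𝔤]

/-- The differential of an affine function. -/
theorem diff_eval_add_const (ξ : 𝔤) (c : ℝ) (x : Module.Dual ℝ 𝔤) :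
    diff (fun y : Module.Dual ℝ 𝔤 => y ξ + c) x = ξ := by
  let L : Module.Dual ℝ 𝔤 →L[ℝ] ℝ := LinearMap.toContinuousLinearMap (Module.evalEquiv ℝ 𝔤 ξ)
  have h : HasFDerivAt (fun y : Module.Dual ℝ 𝔤 => y ξ + c) L x := L.hasFDerivAt.add_const c
  rw [diff, h.fderiv]
  exact (Module.evalEquiv ℝ 𝔤).symm_apply_apply ξ

theorem contDiff_eval (ξ : 𝔤) : ContDiff ℝ ∞ (fun y : Module.Dual ℝ 𝔤 => y ξ) :=
  (LinearMap.toContinuousLinearMap (Module.evalEquiv ℝ 𝔤 ξ)).contDiff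

/-- Compatibility of the Lie-Poisson bracket with a constant bracket is the cocycle identity. -/
theorem DefinesLinearPencil.cocycle {A : LinearMap.BilinForm ℝ 𝔤} (hA : DefinesLinearPencil A)
    (a b c : 𝔤) : A a ⁅b, c⁆ = A ⁅a, b⁆ c + A b ⁅a, c⁆ := by
  -- Brackets of linear functions are affine, and at the origin the Lie–Poisson part vanishes, so
  -- Jacobi for three linear functions leaves only terms in `A`.
  have hP := (hA.2.2.2 1 1).jacobi (fun y => y a) (fun y => y b) (fun y => y c)
    (contDiff_eval a) (contDiff_eval b) (contDiff_eval c) 0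
  have hd : ∀ (ξ : 𝔤) (x : Module.Dual ℝ 𝔤), diff (fun y : Module.Dual ℝ 𝔤 => y ξ) x = ξ := by
    intro ξ x
    simpa using diff_eval_add_const ξ 0 x
  have hb : ∀ ξ η : 𝔤, bracket ((1 : ℝ) • liePoisson 𝔤 + (1 : ℝ) • constPoisson A)
      (fun y => y ξ) (fun y => y η) = fun y => y ⁅ξ, η⁆ + A ξ η := by
    intro ξ η
    ext y
    simp [bracket, hd, liePoisson_apply, constPoisson]
  rw [hb, hb, hb] at hP
  simp only [bracket, hd, diff_eval_add_const, one_smul, Pi.add_apply, LinearMap.add_apply,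
    liePoisson_apply, constPoisson, LinearMap.zero_apply, zero_add] at hP
  have h1 := hA.1.neg_eq a ⁅b, c⁆
  have h2 := hA.1.neg_eq b ⁅a, c⁆
  have h3 : A ⁅c, a⁆ b = -A ⁅a, c⁆ b := by rw [← lie_skew, map_neg, LinearMap.neg_apply]
  linarith

/-- The differential of a first integral: `x([ν, h]) = 0` whenever `v(x) = A(h, ·)`. -/
theorem apply_lie_eq_zero_of_biHamiltonian {A : LinearMap.BilinForm ℝ 𝔤}
    (hA : DefinesLinearPencil A) {ν : 𝔤} (hν : ν ∈ LinearMap.ker A)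
    (hcenter : ∀ η ∈ LinearMap.ker A, ⁅ν, η⁆ = 0)
    (hpos : ∀ ξ : 𝔤, ξ ∉ LinearMap.ker A → 0 < nuForm A ν ξ ξ)
    {U : Set (Module.Dual ℝ 𝔤)} {v : Module.Dual ℝ 𝔤 → Module.Dual ℝ 𝔤}
    (hv : IsBiHamiltonianOn (linearPencil A) U v) {x : Module.Dual ℝ 𝔤} (hx : x ∈ U) {h : 𝔤}
    (hh : v x = A h) : x ⁅ν, h⁆ = 0 := by
  refine apply_bracket_eq_zero_of_orthogonal_kernels
    (LieModule.toEnd ℝ 𝔤 𝔤 : 𝔤 →ₗ[ℝ] Module.End ℝ 𝔤) A (fun a b c => leibniz_lie a b c)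
    (fun a b c => hA.cocycle a b c) hA.1 hν hcenter (fun ξ hξ => (hpos ξ hξ).ne') x h ?_
  intro ε hε n hn
  -- For `λ = ε⁻¹` the vector `n` lies in the kernel of `P_λ(x)`, so `v x n = 0`.
  obtain ⟨H, -, hH⟩ := hv ((ε⁻¹ : ℝ) : OnePoint ℝ)
  have h1 : v x n = x ⁅diff H x, n⁆ - ε⁻¹ * A (diff H x) n := by
    rw [hH x hx]; rfl
  have h2 : A n (diff H x) = ε * x ⁅n, diff H x⁆ := hn _
  rw [← hA.1.neg_eq, ← lie_skew, map_neg, h2, mul_neg, ← mul_assoc, inv_mul_cancel₀ hε, hh] at h1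
  rw [← hA.1.neg_eq, h1]
  ring

/-- Regularity of `v` is not assumed: it comes from `v = A dH` with `A` constant and `H` smooth. -/
theorem contDiffOn_of_isHamiltonianOn_const {A : LinearMap.BilinForm ℝ 𝔤}
    {U : Set (Module.Dual ℝ 𝔤)} (hU : IsOpen U) {v : Module.Dual ℝ 𝔤 → Module.Dual ℝ 𝔤}
    (hv : IsHamiltonianOn (constPoisson A) U v) : ContDiffOn ℝ 1 v U := by
  obtain ⟨H, hH, hvH⟩ := hv
  let L : (Module.Dual ℝ 𝔤 →L[ℝ] ℝ) →ₗ[ℝ] Module.Dual ℝ 𝔤 :=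
    A ∘ₗ (Module.evalEquiv ℝ 𝔤).symm.toLinearMap ∘ₗ ContinuousLinearMap.coeLM ℝ
  have hd : ContDiffOn ℝ 1 (fderiv ℝ H) U := hH.fderiv_of_isOpen hU (by norm_cast)
  exact ((LinearMap.toContinuousLinearMap L).contDiff.comp_contDiffOn hd).congr hvH

/-- The quadratic first integral of a compact linear pencil. -/
theorem exists_quadratic_integral {A : LinearMap.BilinForm ℝ 𝔤}
    (hA : DefinesLinearPencil A) {ν : 𝔤} (hν : ν ∈ LinearMap.ker A)
    (hcenter : ∀ η ∈ LinearMap.ker A, ⁅ν, η⁆ = 0)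
    (hpos : ∀ ξ : 𝔤, ξ ∉ LinearMap.ker A → 0 < nuForm A ν ξ ξ) :
    ∃ q : LinearMap.BilinForm ℝ (Module.Dual ℝ 𝔤), (∀ x y, q x y = q y x) ∧
      (∀ x, x ≠ 0 → 0 < q x x) ∧
      ∀ (x : Module.Dual ℝ 𝔤) (h : 𝔤), x ⁅ν, h⁆ = 0 → q x (A h) = 0 := by
  set S := nuForm A ν with hSdef
  have hSapp : ∀ a b, S a b = A ⁅ν, a⁆ b := fun _ _ => rfl
  have hskew : ∀ a b, A a b = -A b a := fun a b => (hA.1.neg_eq b a).symm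
  have hν0 : ∀ a, A ν a = 0 := fun a => by rw [LinearMap.mem_ker.1 hν]; rfl
  have hinv : ∀ a b, A ⁅ν, a⁆ b = -A a ⁅ν, b⁆ := fun a b => by
    have := hA.cocycle ν a b
    rw [hν0] at this
    linarith
  have hS : ∀ a b, S a b = S b a := fun a b => by
    rw [hSapp, hSapp, hinv, hskew, neg_neg]
  have hnonneg : ∀ a, 0 ≤ S a a := fun a => by
    by_cases ha : a ∈ LinearMap.ker A
    · rw [hSapp, hcenter a ha, map_zero, LinearMap.zero_apply]
    · exact (hpos a ha).le
  have hzero : ∀ a, S a a = 0 → a ∈ LinearMap.ker A := fun a ha => by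
    by_contra h
    exact (hpos a h).ne' ha
  have hker : LinearMap.ker S = LinearMap.ker A := by
    ext a
    refine ⟨fun ha => hzero a (by rw [LinearMap.mem_ker.1 ha]; rfl), fun ha => ?_⟩
    ext b
    rw [hSapp, hcenter a ha, map_zero]
  obtain ⟨ζ, hζ⟩ := exists_linearMap_apply_eq_of_ker_le hS
    (LinearMap.dualMap (LieModule.toEnd ℝ 𝔤 𝔤 ν)) (fun x k hk => by
      rw [hker] at hk
      rw [LinearMap.dualMap_apply, LieModule.toEnd_apply_apply, hcenter k hk, map_zero])
  have hζ' : ∀ x b, S (ζ x) b = x ⁅ν, b⁆ := fun x b => by rw [hζ]; rfl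
  let κ := Module.finBasis ℝ (LinearMap.ker A)
  let ev : 𝔤 → Module.Dual ℝ 𝔤 →ₗ[ℝ] ℝ := fun a => Module.evalEquiv ℝ 𝔤 a
  -- The first term detects `x` on `[ν, 𝔤]`, the second on `Ker A`.
  let q : LinearMap.BilinForm ℝ (Module.Dual ℝ 𝔤) :=
    S.compl₁₂ ζ ζ + ∑ i, (LinearMap.mul ℝ ℝ).compl₁₂ (ev (κ i)) (ev (κ i))
  have hq : ∀ x y, q x y = S (ζ x) (ζ y) + ∑ i, x (κ i) * y (κ i) := fun x y => by
    simp [q, ev, LinearMap.sum_apply]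
  refine ⟨q, fun x y => ?_, fun x hx => ?_, fun x h hxh => ?_⟩
  · rw [hq, hq, hS]
    simp only [mul_comm]
  · have hsum : 0 ≤ ∑ i, x (κ i) * x (κ i) := Finset.sum_nonneg fun i _ => mul_self_nonneg _
    rw [hq]
    refine lt_of_le_of_ne (add_nonneg (hnonneg _) hsum) fun h0 => hx ?_
    have h1 : S (ζ x) (ζ x) = 0 := by linarith [hnonneg (ζ x)]
    have h2 : ∑ i, x (κ i) * x (κ i) = 0 := by linarith [hnonneg (ζ x)]
    have hxν : ∀ b, x ⁅ν, b⁆ = 0 := fun b => by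
      have : ζ x ∈ LinearMap.ker S := hker ▸ hzero _ h1
      rw [← hζ', LinearMap.mem_ker.1 this]; rfl
    have hxκ : x ∘ₗ (LinearMap.ker A).subtype = 0 := κ.ext fun i =>
      mul_self_eq_zero.1 ((Finset.sum_eq_zero_iff_of_nonneg fun i _ => mul_self_nonneg _).1 h2 i
        (Finset.mem_univ i))
    obtain ⟨η, rfl⟩ := exists_apply_eq_of_ker_le hS (y := x) (fun k hk => by
      rw [hker] at hk
      exact LinearMap.congr_fun hxκ ⟨k, hk⟩)
    -- As `x = S η` kills `[ν, [ν, η]]`, invariance gives `S [ν, η] [ν, η] = 0`.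
    have h3 : ⁅ν, η⁆ ∈ LinearMap.ker A := hzero _ (by
      rw [hSapp, hinv, ← hSapp, hxν, neg_zero])
    have h4 : η ∈ LinearMap.ker S := hker ▸ hzero η (by rw [hSapp, LinearMap.mem_ker.1 h3]; rfl)
    exact LinearMap.mem_ker.1 h4
  -- Here `S (ζ x) (ζ (A h)) = A h [ν, ζ x] = -S (ζ x) h = -x([ν, h])`; the other term drops out
  -- because `A h` vanishes on `Ker A`.
  · have h1 : S (ζ x) (ζ (A h)) = 0 := by
      rw [hS, hζ', hskew, ← hSapp, hζ', hxh, neg_zero]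
    have h2 : ∀ i, A h (κ i) = 0 := fun i => by
      rw [hskew, LinearMap.mem_ker.1 (κ i).2, LinearMap.zero_apply, neg_zero]
    simp [hq, h1, h2]

end LinearPencil

end BiHam

theorem mainTheorem3 {𝔤 : Type*} [LieRing 𝔤] [LieAlgebra ℝ 𝔤] [FiniteDimensional ℝ 𝔤]
    (A : LinearMap.BilinForm ℝ 𝔤)
    (hA : BiHam.DefinesLinearPencil A)
    (hcompact : BiHam.IsCompactLinearPencil A)
    (U : Set (Module.Dual ℝ 𝔤)) (hU : IsOpen U) (h0 : (0 : Module.Dual ℝ 𝔤) ∈ U)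
    (v : Module.Dual ℝ 𝔤 → Module.Dual ℝ 𝔤)
    (hv : BiHam.IsBiHamiltonianOn (BiHam.linearPencil A) U v) :
    BiHam.IsStableEquilibrium U v 0 := by
  obtain ⟨ν, hν, hcenter, hpos⟩ := hcompact
  obtain ⟨q, hsymm, hqpos, hq⟩ := BiHam.exists_quadratic_integral hA hν hcenter hpos
  have hinf : BiHam.IsHamiltonianOn (BiHam.constPoisson A) U v := hv OnePoint.infty
  have hv0 : v 0 = 0 := by
    -- The member `λ = 0` of the pencil is the Lie–Poisson tensor, which vanishes at the origin.
    obtain ⟨H, -, hH⟩ := hv ((0 : ℝ) : OnePoint ℝ)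
    have h : v 0 = (BiHam.liePoisson 𝔤 - (0 : ℝ) • BiHam.constPoisson A) 0 (BiHam.diff H 0) :=
      hH 0 h0
    rw [h, zero_smul, sub_zero]
    ext η
    simp [BiHam.liePoisson_apply]
  let Q : Module.Dual ℝ 𝔤 →L[ℝ] Module.Dual ℝ 𝔤 →L[ℝ] ℝ := LinearMap.toContinuousLinearMap
    ((LinearMap.toContinuousLinearMap : (Module.Dual ℝ 𝔤 →ₗ[ℝ] ℝ) ≃ₗ[ℝ] _).toLinearMap ∘ₗ q)
  refine BiHam.isStableEquilibrium_of_quadratic_integral Q hsymm hqpos hU h0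
    (BiHam.contDiffOn_of_isHamiltonianOn_const hU hinf) hv0 fun x hx => ?_
  obtain ⟨H, -, hH⟩ := hinf
  have hvx : v x = A (BiHam.diff H x) := hH x hx
  rw [hvx]
  exact hq x _ (BiHam.apply_lie_eq_zero_of_biHamiltonian hA hν hcenter hpos hv hx hvx)
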